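/- Let $(M,g)$ be a smooth Lorentzian manifold of signature $(-,+,\dots,+)$, with Levi-Civita connection $\nabla$, and let $Z$ be a smooth vector field on an open subset $\mathscr U\subseteq M$ that is null ($Z_x\neq 0$ and $g(Z_x,Z_x)=0$ for all $x\in\mathscr U$) and parallel ($\nabla Z=0$). Let $Z_\perp=\{X\in T\mathscr U : g(X,Z)=0\}$ and let $Z_\perp/Z$ be the wavefront bundle, whose fibre at $x$ is $Z_x^\perp/\mathbb R Z_x$; its sections are the classes $[X]$ of smooth vector fields $X\in\Gamma(Z_\perp)$ under $X\sim Y\iff Y=X+fZ$ for some $f\in C^\infty(\mathscr U)$. Then: 1. The formula $\bar g([X],[Y])=g(X,Y)$ gives a well-defined, symmetric, positive-definite inner product on every fibre of $Z_\perp/Z$, and a well-defined $C^\infty(\mathscr U)$-bilinear map $\Gamma(Z_\perp/Z)\times\Gamma(Z_\perp/Z)\to C^\infty(\mathscr U)$. 2. For $V\in\mathfrak X(\mathscr U)$ and $Y\in\Gamma(Z_\perp)$ one has $\nabla_VY\in\Gamma(Z_\perp)$, and the formula $\overline\nabla_V[Y]=[\nabla_VY]$ gives a well-defined linear connection $\overline\nabla:\mathfrak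 X(\mathscr U)\times\Gamma(Z_\perp/Z)\to\Gamma(Z_\perp/Z)$. 3. The connection $\overline\nabla$ is flat (that is, $\overline\nabla_V\overline\nabla_W s-\overline\nabla_W\overline\nabla_V s-\overline\nabla_{[V,W]}s=0$ for all $V,W\in\mathfrak X(\mathscr U)$ and $s\in\Gamma(Z_\perp/Z)$) if and only if the curvature tensor $R$ of $\nabla$ satisfies $R|_{Z_\perp\wedge Z_\perp}=0$, i.e. $R(X,Y)V=0$ for all $X,Y\in\Gamma(Z_\perp)$ and $V\in\mathfrak X(\mathscr U)$. Likewise, $\overline\nabla$ is flat if and only if $(\mathscr U,g|_{\mathscr U})$ is a pp-wave, i.e. admits some smooth null parallel vector field $Z'$ on $\mathscr U$ with $R|_{Z'_\perp\wedge Z'_\perp}=0$. -/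

import Mathlib

open Bundle
open scoped Manifold ContDiff Topology

noncomputable section

namespace PPWave

section Fields

variable (E : Type*) [NormedAddCommGroup E] [NormedSpace ℝ E]
  (N : Type*) [TopologicalSpace N] [ChartedSpace E N]

/-- The ring `C^∞(N)` of smooth real functions on a manifold `N` modelled on `E`. -/
abbrev Fn : Type _ := C^∞⟮𝓘(ℝ, E), N; 𝓘(ℝ, ℝ), ℝ⟯

variable [IsManifold 𝓘(ℝ, E) ∞ N]

/-- The smooth vector fields `𝔛(N)`. -/
abbrev VF : Type _ := Cₛ^∞⟮𝓘(ℝ, E); E, (TangentSpace 𝓘(ℝ, E) : N → Type _)⟯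

variable {E N}

instance : SMul (Fn E N) (VF E N) :=
  ⟨fun f X => ⟨fun x => f x • X x, f.contMDiff.smul_section X.contMDiff⟩⟩

@[simp]
theorem smul_apply (f : Fn E N) (X : VF E N) (x : N) : (f • X) x = f x • X x := rfl

/-- `𝔛(N)` is a `C^∞(N)`-module under pointwise multiplication. -/
instance : Module (Fn E N) (VF E N) where
  one_smul X := by ext x; simp
  mul_smul f h X := by ext x; simp [mul_smul]
  smul_zero f := by ext x; simp
  smul_add f X Y := by ext x; simp
  add_smul f h X := by ext x; simp [add_smul]
  zero_smul X := by ext x; simp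

/-- The derivative `V f` of a function `f` along a vector field `V`. -/
def dirDeriv (V : VF E N) (f : Fn E N) : Fn E N :=
  ⟨fun x => mvfderiv 𝓘(ℝ, E) f x (V x), by
    have h1 := f.contMDiff.contMDiff_tangentMap (m := ∞) (by simp)
    have h2 := h1.comp V.contMDiff
    intro x
    have h3 := (contMDiffAt_totalSpace.1 (h2 x)).2
    simpa [tangentMap, mvfderiv] using! h3⟩

/-- The Lie bracket `[V, W]` of vector fields. -/
def bracket [FiniteDimensional ℝ E] (V W : VF E N) : VF E N :=
  ⟨VectorField.mlieBracket 𝓘(ℝ, E) V W, by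
    have : CompleteSpace E := FiniteDimensional.complete ℝ E
    have : IsManifold 𝓘(ℝ, E) (minSmoothness ℝ 2) N := by
      rw [minSmoothness_of_isRCLikeNormedField]; infer_instance
    have : IsManifold 𝓘(ℝ, E) (((⊤ : ℕ∞) : ℕ∞ω) + 1) N := by
      simpa using (inferInstance : IsManifold 𝓘(ℝ, E) ∞ N)
    exact ContDiff.mlieBracket_vectorField V.contMDiff W.contMDiff (by simp)⟩

end Fields

/-- The differential at `x` of the inclusion of an open set. -/
def dIncl {E : Type*} [NormedAddCommGroup E] [NormedSpace ℝ E]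
    {N : Type*} [TopologicalSpace N] [ChartedSpace E N] (U : TopologicalSpace.Opens N) (x : U) :
    TangentSpace 𝓘(ℝ, E) x →L[ℝ] TangentSpace 𝓘(ℝ, E) (x : N) :=
  mfderiv 𝓘(ℝ, E) 𝓘(ℝ, E) (Subtype.val : U → N) x

theorem dIncl_bijective {E : Type*} [NormedAddCommGroup E] [NormedSpace ℝ E]
    {N : Type*} [TopologicalSpace N] [ChartedSpace E N] (U : TopologicalSpace.Opens N) (x : U) :
    Function.Bijective (dIncl (E := E) U x) := by
  have hd : MDifferentiableAt 𝓘(ℝ, E) 𝓘(ℝ, E) (Subtype.val : U → N) x :=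
    (contMDiff_subtype_val (n := 1)).mdifferentiableAt one_ne_zero
  have hw : writtenInExtChartAt 𝓘(ℝ, E) 𝓘(ℝ, E) x (Subtype.val : U → N)
      =ᶠ[𝓝 (extChartAt 𝓘(ℝ, E) x x)] id := by
    have h1 := TopologicalSpace.Opens.chartAt_subtype_val_symm_eventuallyEq (H := E) U (x := x)
    have h2 : ∀ᶠ y in 𝓝 (chartAt E (x : N) (x : N)), y ∈ (chartAt E (x : N)).target :=
      (chartAt E (x : N)).open_target.mem_nhds (mem_chart_target E (x : N))
    filter_upwards [h1, h2] with y hy hy2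
    have : (Subtype.val ((chartAt E x).symm y) : N) = (chartAt E (x : N)).symm y := hy.symm
    simp [writtenInExtChartAt, this, hy2]
  have : dIncl U x = ContinuousLinearMap.id ℝ E := by
    have h := hd.mfderiv
    simp only [modelWithCornersSelf_coe, Set.range_id, fderivWithin_univ] at h
    exact h.trans (hw.fderiv_eq.trans fderiv_id)
  rw [this]
  exact Function.bijective_id

/-- A family of bilinear forms is smooth if all its values on constant vectors are. -/
theorem contMDiffAt_clm₂ {E : Type*} [NormedAddCommGroup E] [NormedSpace ℝ E]
    [FiniteDimensional ℝ E] {N : Type*} [TopologicalSpace N] [ChartedSpace E N]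
    {f : N → E →L[ℝ] E →L[ℝ] ℝ} {x : N}
    (h : ∀ v w : E, ContMDiffAt 𝓘(ℝ, E) 𝓘(ℝ, ℝ) ∞ (fun y => f y v w) x) :
    ContMDiffAt 𝓘(ℝ, E) 𝓘(ℝ, E →L[ℝ] E →L[ℝ] ℝ) ∞ f x := by
  let b := Module.finBasis ℝ E
  let c := fun i => LinearMap.toContinuousLinearMap (b.coord i)
  have hf : f = fun y => ∑ i, ∑ j, f y (b i) (b j) • (c i).smulRight (c j) := by
    ext y v w
    conv_lhs => rw [← b.sum_repr v, ← b.sum_repr w]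
    simp only [map_sum, map_smul, sum_apply, _root_.smul_apply,
      ContinuousLinearMap.smulRight_apply, smul_eq_mul, Finset.mul_sum]
    rw [Finset.sum_comm]
    refine Finset.sum_congr rfl fun i _ => Finset.sum_congr rfl fun j _ => ?_
    simp only [c, LinearMap.coe_toContinuousLinearMap', Module.Basis.coord_apply]
    ring
  rw [hf]
  refine ContMDiffAt.sum fun i _ => ContMDiffAt.sum fun j _ => (h _ _).smul contMDiffAt_const

section Metric

variable (E : Type*) [NormedAddCommGroup E] [NormedSpace ℝ E]
  (N : Type*) [TopologicalSpace N] [ChartedSpace E N] [IsManifold 𝓘(ℝ, E) ∞ N]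

/-- A smooth Lorentzian metric, of signature `(-, +, …, +)`: in every tangent space there is a
vector `v` with `g(v, v) < 0` on whose orthogonal complement `g` is positive definite. -/
structure LorentzianMetric where
  inner (x : N) : TangentSpace 𝓘(ℝ, E) x →L[ℝ] TangentSpace 𝓘(ℝ, E) x →L[ℝ] ℝ
  symm (x : N) (v w : TangentSpace 𝓘(ℝ, E) x) : inner x v w = inner x w v
  signature (x : N) : ∃ v : TangentSpace 𝓘(ℝ, E) x, inner x v v < 0 ∧
    ∀ w : TangentSpace 𝓘(ℝ, E) x, inner x v w = 0 → w ≠ 0 → 0 < inner x w w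
  contMDiff : ContMDiff 𝓘(ℝ, E) (𝓘(ℝ, E).prod 𝓘(ℝ, E →L[ℝ] E →L[ℝ] ℝ)) ∞
    (fun x ↦ TotalSpace.mk' (E →L[ℝ] E →L[ℝ] ℝ)
      (E := fun x : N => TangentSpace 𝓘(ℝ, E) x →L[ℝ] TangentSpace 𝓘(ℝ, E) x →L[ℝ] ℝ) x (inner x))

variable {E N}

/-- The restriction `g|_U` of a Lorentzian metric to an open set, i.e. its pull-back under the
inclusion. -/
def LorentzianMetric.restrict [FiniteDimensional ℝ E] (g : LorentzianMetric E N)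
    (U : TopologicalSpace.Opens N) :
    LorentzianMetric E U where
  inner x := ((dIncl U x).precomp ℝ) ∘L (g.inner x) ∘L (dIncl U x)
  symm x v w := g.symm _ _ _
  signature x := by
    obtain ⟨v, hv, hw⟩ := g.signature x
    obtain ⟨v', rfl⟩ := (dIncl_bijective (E := E) U x).2 v
    exact ⟨v', hv, fun w h1 h2 => hw _ h1 fun h0 =>
      h2 ((dIncl_bijective (E := E) U x).1 (h0.trans (map_zero _).symm))⟩
  contMDiff := by
    intro x₀
    rw [contMDiffAt_hom_bundle]
    refine ⟨contMDiffAt_id, ?_⟩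
    apply contMDiffAt_clm₂
    intro v w
    have hs : ∀ v : E, ContMDiffAt 𝓘(ℝ, E) (𝓘(ℝ, E).prod 𝓘(ℝ, E)) ∞
        (fun y : U => TotalSpace.mk' E (E := fun y : N => TangentSpace 𝓘(ℝ, E) y) (y : N)
          (dIncl U y ((trivializationAt E (TangentSpace 𝓘(ℝ, E)) x₀).symm y v))) x₀ := by
      intro v
      have hbase := (trivializationAt E (TangentSpace 𝓘(ℝ, E)) x₀).apply_mk_symm
        (FiberBundle.mem_baseSet_trivializationAt' x₀) v
      have h1 := FiberBundle.contMDiffAt_extend 𝓘(ℝ, E) E (k := ∞) (x := x₀)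
        ((trivializationAt E (TangentSpace 𝓘(ℝ, E)) x₀).symm x₀ v)
      have h2 := (contMDiff_subtype_val (I := 𝓘(ℝ, E)) (n := ∞)
        (U := U)).contMDiff_tangentMap (m := ∞) (by simp)
      have h3 := (h2 _).comp x₀ h1
      refine h3.congr_of_eventuallyEq (Filter.Eventually.of_forall fun y => ?_)
      simp only [tangentMap, FiberBundle.extend, dIncl, Function.comp_apply]
      rw [hbase]
    have hg := (g.contMDiff (x₀ : N)).comp x₀ (contMDiff_subtype_val (n := ∞) (U := U) x₀)
    have h := ContMDiffAt.clm_bundle_apply₂ (E₃ := Bundle.Trivial N ℝ) (F₃ := ℝ) hg (hs v) (hs w)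
    have h' := (contMDiffAt_totalSpace.1 h).2
    refine h'.congr_of_eventuallyEq ?_
    filter_upwards [(trivializationAt E (TangentSpace 𝓘(ℝ, E)) x₀).open_baseSet.mem_nhds
      (FiberBundle.mem_baseSet_trivializationAt' x₀)] with y hy
    rw [inCoordinates_apply_eq₂ hy hy (by simp)]
    simp

end Metric

section LeviCivita

variable {E : Type*} [NormedAddCommGroup E] [NormedSpace ℝ E]
  {N : Type*} [TopologicalSpace N] [ChartedSpace E N] [IsManifold 𝓘(ℝ, E) ∞ N]

/-- The right-hand side of the Koszul formula,
`X g(Y, W) + Y g(W, X) - W g(X, Y) + g([X, Y], W) - g([Y, W], X) + g([W, X], Y)`, at `x`. -/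
def koszul (g : LorentzianMetric E N) (X Y W : (x : N) → TangentSpace 𝓘(ℝ, E) x) (x : N) : ℝ :=
  mvfderiv 𝓘(ℝ, E) (fun y => g.inner y (Y y) (W y)) x (X x)
    + mvfderiv 𝓘(ℝ, E) (fun y => g.inner y (W y) (X y)) x (Y x)
    - mvfderiv 𝓘(ℝ, E) (fun y => g.inner y (X y) (Y y)) x (W x)
    + g.inner x (VectorField.mlieBracket 𝓘(ℝ, E) X Y x) (W x)
    - g.inner x (VectorField.mlieBracket 𝓘(ℝ, E) Y W x) (X x)
    + g.inner x (VectorField.mlieBracket 𝓘(ℝ, E) W X x) (Y x)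

open Classical in
/-- The Levi-Civita covariant derivative `∇_X Y` at `x`: the vector `u` given by the Koszul formula
`2 g(u, W) = koszul g X Y W` for all vector fields `W`. -/
def leviCivita (g : LorentzianMetric E N) (X Y : (x : N) → TangentSpace 𝓘(ℝ, E) x) (x : N) :
    TangentSpace 𝓘(ℝ, E) x :=
  if h : ∃ u : TangentSpace 𝓘(ℝ, E) x, ∀ W : (x : N) → TangentSpace 𝓘(ℝ, E) x,
      MDifferentiableAt 𝓘(ℝ, E) (𝓘(ℝ, E).prod 𝓘(ℝ, E))
        (fun y => TotalSpace.mk' E (E := fun y : N => TangentSpace 𝓘(ℝ, E) y) y (W y)) x →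
      2 * g.inner x u (W x) = koszul g X Y W x
  then h.choose else 0

theorem LorentzianMetric.eq_zero_of_inner (g : LorentzianMetric E N) (x : N)
    (u : TangentSpace 𝓘(ℝ, E) x) (h : ∀ w, g.inner x u w = 0) : u = 0 := by
  obtain ⟨v, -, hv⟩ := g.signature x
  by_contra hu
  exact (hv u ((g.symm x v u).trans (h v)) hu).ne' (h u)

theorem LorentzianMetric.mdifferentiableAt_inner (g : LorentzianMetric E N)
    {X Y : (x : N) → TangentSpace 𝓘(ℝ, E) x} {x : N}
    (hX : MDifferentiableAt 𝓘(ℝ, E) (𝓘(ℝ, E).prod 𝓘(ℝ, E))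
      (fun y => TotalSpace.mk' E (E := fun y : N => TangentSpace 𝓘(ℝ, E) y) y (X y)) x)
    (hY : MDifferentiableAt 𝓘(ℝ, E) (𝓘(ℝ, E).prod 𝓘(ℝ, E))
      (fun y => TotalSpace.mk' E (E := fun y : N => TangentSpace 𝓘(ℝ, E) y) y (Y y)) x) :
    MDifferentiableAt 𝓘(ℝ, E) 𝓘(ℝ, ℝ) (fun y => g.inner y (X y) (Y y)) x := by
  have hg := (g.contMDiff x).mdifferentiableAt (by simp)
  have h := MDifferentiableAt.clm_bundle_apply₂ (E₃ := Bundle.Trivial N ℝ) (F₃ := ℝ) hg hX hY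
  exact (mdifferentiableAt_totalSpace _ _ |>.1 h).2

variable [FiniteDimensional ℝ E]

theorem LorentzianMetric.exists_inner_eq (g : LorentzianMetric E N) (x : N)
    (φ : TangentSpace 𝓘(ℝ, E) x →L[ℝ] ℝ) : ∃ u, ∀ w, g.inner x u w = φ w := by
  have : FiniteDimensional ℝ (TangentSpace 𝓘(ℝ, E) x) := inferInstanceAs (FiniteDimensional ℝ E)
  let L : TangentSpace 𝓘(ℝ, E) x →ₗ[ℝ] Module.Dual ℝ (TangentSpace 𝓘(ℝ, E) x) :=
    ContinuousLinearMap.coeLM ℝ ∘ₗ (g.inner x).toLinearMap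
  have hinj : Function.Injective L := by
    refine (injective_iff_map_eq_zero L).2 fun u hu => g.eq_zero_of_inner x u fun w => ?_
    exact congrArg (fun f => f w) hu
  have hsurj : Function.Surjective L :=
    (LinearMap.injective_iff_surjective_of_finrank_eq_finrank
      (Subspace.dual_finrank_eq (K := ℝ)).symm).1 hinj
  obtain ⟨u, hu⟩ := hsurj φ.toLinearMap
  exact ⟨u, fun w => congrArg (fun f => f w) hu⟩

/-- The Koszul expression is tensorial in its last argument. -/
theorem koszul_tensorial (g : LorentzianMetric E N)
    {X Y : (x : N) → TangentSpace 𝓘(ℝ, E) x} {x : N}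
    (hX : MDifferentiableAt 𝓘(ℝ, E) (𝓘(ℝ, E).prod 𝓘(ℝ, E))
      (fun y => TotalSpace.mk' E (E := fun y : N => TangentSpace 𝓘(ℝ, E) y) y (X y)) x)
    (hY : MDifferentiableAt 𝓘(ℝ, E) (𝓘(ℝ, E).prod 𝓘(ℝ, E))
      (fun y => TotalSpace.mk' E (E := fun y : N => TangentSpace 𝓘(ℝ, E) y) y (Y y)) x) :
    TensorialAt 𝓘(ℝ, E) E (fun W : (x : N) → TangentSpace 𝓘(ℝ, E) x => koszul g X Y W x) x where
  smul {f W} hf hW := by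
    have : CompleteSpace E := FiniteDimensional.complete ℝ E
    have h1 : (fun y => g.inner y (Y y) ((f • W) y)) = fun y => f y * g.inner y (Y y) (W y) := by
      ext y; simp
    have h2 : (fun y => g.inner y ((f • W) y) (X y)) = fun y => f y * g.inner y (W y) (X y) := by
      ext y; simp
    have h3 := mvfderiv_fun_mul hf (g.mdifferentiableAt_inner hY hW)
    have h4 := mvfderiv_fun_mul hf (g.mdifferentiableAt_inner hW hX)
    simp only [koszul, h1, h2, h3, h4, VectorField.mlieBracket_smul_right hf hW,
      VectorField.mlieBracket_smul_left hf hW]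
    simp
    rw [g.symm x (Y x) (W x)]
    ring
  add {W W'} hW hW' := by
    have : CompleteSpace E := FiniteDimensional.complete ℝ E
    have h1 : (fun y => g.inner y (Y y) ((W + W') y))
        = fun y => g.inner y (Y y) (W y) + g.inner y (Y y) (W' y) := by
      ext y; simp
    have h2 : (fun y => g.inner y ((W + W') y) (X y))
        = fun y => g.inner y (W y) (X y) + g.inner y (W' y) (X y) := by
      ext y; simp
    have h3 := mvfderiv_fun_add (g.mdifferentiableAt_inner hY hW) (g.mdifferentiableAt_inner hY hW')
    have h4 := mvfderiv_fun_add (g.mdifferentiableAt_inner hW hX) (g.mdifferentiableAt_inner hW' hX)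
    simp only [koszul, h1, h2, h3, h4, VectorField.mlieBracket_add_right hW hW',
      VectorField.mlieBracket_add_left hW hW']
    simp
    ring

/-- The Koszul formula holds, so `leviCivita` never takes its default value on differentiable
vector fields. -/
theorem leviCivita_spec (g : LorentzianMetric E N)
    {X Y W : (x : N) → TangentSpace 𝓘(ℝ, E) x} {x : N}
    (hX : MDifferentiableAt 𝓘(ℝ, E) (𝓘(ℝ, E).prod 𝓘(ℝ, E))
      (fun y => TotalSpace.mk' E (E := fun y : N => TangentSpace 𝓘(ℝ, E) y) y (X y)) x)
    (hY : MDifferentiableAt 𝓘(ℝ, E) (𝓘(ℝ, E).prod 𝓘(ℝ, E))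
      (fun y => TotalSpace.mk' E (E := fun y : N => TangentSpace 𝓘(ℝ, E) y) y (Y y)) x)
    (hW : MDifferentiableAt 𝓘(ℝ, E) (𝓘(ℝ, E).prod 𝓘(ℝ, E))
      (fun y => TotalSpace.mk' E (E := fun y : N => TangentSpace 𝓘(ℝ, E) y) y (W y)) x) :
    2 * g.inner x (leviCivita g X Y x) (W x) = koszul g X Y W x := by
  have h := koszul_tensorial g hX hY
  obtain ⟨u, hu⟩ := g.exists_inner_eq x ((1 / 2 : ℝ) • TensorialAt.mkHom _ x h)
  have hex : ∃ u : TangentSpace 𝓘(ℝ, E) x, ∀ W : (x : N) → TangentSpace 𝓘(ℝ, E) x,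
      MDifferentiableAt 𝓘(ℝ, E) (𝓘(ℝ, E).prod 𝓘(ℝ, E))
        (fun y => TotalSpace.mk' E (E := fun y : N => TangentSpace 𝓘(ℝ, E) y) y (W y)) x →
      2 * g.inner x u (W x) = koszul g X Y W x := by
    refine ⟨u, fun W hW => ?_⟩
    rw [hu, ← TensorialAt.mkHom_apply h hW, _root_.smul_apply, smul_eq_mul]
    ring
  rw [leviCivita, dif_pos hex]
  exact hex.choose_spec W hW

/-- `∇` is torsion free: `∇_X Y - ∇_Y X = [X, Y]`. -/
theorem leviCivita_torsion (g : LorentzianMetric E N) (X Y : VF E N) (x : N) :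
    leviCivita g X Y x - leviCivita g Y X x = bracket X Y x := by
  rw [← sub_eq_zero]
  refine g.eq_zero_of_inner x _ fun w => ?_
  have hW := FiberBundle.mdifferentiableAt_extend 𝓘(ℝ, E) E w
  have h1 := leviCivita_spec g X.mdifferentiableAt Y.mdifferentiableAt hW
  have h2 := leviCivita_spec g Y.mdifferentiableAt X.mdifferentiableAt hW
  have hc : ∀ A B : (x : N) → TangentSpace 𝓘(ℝ, E) x,
      (fun y => g.inner y (A y) (B y)) = fun y => g.inner y (B y) (A y) := fun A B => by
    ext y; exact g.symm _ _ _
  simp only [koszul, FiberBundle.extend_apply_self] at h1 h2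
  rw [hc Y (FiberBundle.extend E w), hc X Y,
    VectorField.mlieBracket_swap_apply (V := Y) (W := FiberBundle.extend E w)] at h1
  rw [hc X (FiberBundle.extend E w),
    VectorField.mlieBracket_swap_apply (V := X) (W := FiberBundle.extend E w),
    VectorField.mlieBracket_swap_apply (V := Y) (W := X)] at h2
  have hb : bracket X Y x = VectorField.mlieBracket 𝓘(ℝ, E) X Y x := rfl
  rw [hb]
  simp at h1 h2 ⊢
  linarith

/-- `∇` is metric: `X g(Y, W) = g(∇_X Y, W) + g(Y, ∇_X W)`. -/
theorem leviCivita_metric (g : LorentzianMetric E N) (X Y W : VF E N) (x : N) :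
    mvfderiv 𝓘(ℝ, E) (fun y => g.inner y (Y y) (W y)) x (X x)
      = g.inner x (leviCivita g X Y x) (W x) + g.inner x (Y x) (leviCivita g X W x) := by
  have h1 := leviCivita_spec g X.mdifferentiableAt Y.mdifferentiableAt W.mdifferentiableAt (x := x)
  have h2 := leviCivita_spec g X.mdifferentiableAt W.mdifferentiableAt Y.mdifferentiableAt (x := x)
  have hc : ∀ A B : (x : N) → TangentSpace 𝓘(ℝ, E) x,
      (fun y => g.inner y (A y) (B y)) = fun y => g.inner y (B y) (A y) := fun A B => by
    ext y; exact g.symm _ _ _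
  rw [g.symm x (Y x)]
  simp only [koszul] at h1 h2
  rw [hc W X, VectorField.mlieBracket_swap_apply (V := W) (W := X)] at h1
  rw [hc W Y, hc Y X, VectorField.mlieBracket_swap_apply (V := W) (W := Y),
    VectorField.mlieBracket_swap_apply (V := Y) (W := X)] at h2
  simp at h1 h2
  linarith

end LeviCivita

section Wavefront

variable {E : Type*} [NormedAddCommGroup E] [NormedSpace ℝ E]
  {N : Type*} [TopologicalSpace N] [ChartedSpace E N] [IsManifold 𝓘(ℝ, E) ∞ N]
  (g : LorentzianMetric E N) (Z : VF E N)

/-- `Z` is null; the zero vector does not count as null, so `Z` vanishes nowhere. -/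
def IsNull : Prop := ∀ x, Z x ≠ 0 ∧ g.inner x (Z x) (Z x) = 0

/-- `Z` is parallel (covariantly constant): `∇ Z = 0`. -/
def IsParallel : Prop := ∀ (V : VF E N) (x : N), leviCivita g V Z x = 0

/-- The fibre of `Z_⊥` at `x`. -/
def perpAt (x : N) : Submodule ℝ (TangentSpace 𝓘(ℝ, E) x) where
  carrier := {v | g.inner x v (Z x) = 0}
  add_mem' {v w} hv hw := by
    have hv : g.inner x v (Z x) = 0 := hv
    have hw : g.inner x w (Z x) = 0 := hw
    simp [hv, hw]
  zero_mem' := by simp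
  smul_mem' c v hv := by
    have hv : g.inner x v (Z x) = 0 := hv
    simp [hv]

/-- The fibre of the wavefront bundle `Z_⊥ / Z` at `x`. -/
abbrev WavefrontAt (x : N) : Type _ :=
  perpAt g Z x ⧸ (Submodule.span ℝ {Z x}).submoduleOf (perpAt g Z x)

/-- The class in `Z_⊥ / Z` of a tangent vector orthogonal to `Z`. -/
def clsAt {x : N} (v : perpAt g Z x) : WavefrontAt g Z x := Submodule.Quotient.mk v

/-- The `C^∞(N)`-module `Γ(Z_⊥)` of smooth vector fields orthogonal to `Z`. -/
def perp : Submodule (Fn E N) (VF E N) where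
  carrier := {X | ∀ x, g.inner x (X x) (Z x) = 0}
  add_mem' {X Y} hX hY x := by simp [hX x, hY x]
  zero_mem' x := by simp
  smul_mem' f X hX x := by simp [hX x]

/-- The value at `x` of a section of `Z_⊥`. -/
def evalAt (X : perp g Z) (x : N) : perpAt g Z x := ⟨X.1 x, X.2 x⟩

/-- The `C^∞(N)`-module `Γ(Z_⊥ / Z)`: vector fields orthogonal to `Z`, where `X ∼ Y` if and only if
`Y = X + f Z` for some smooth function `f`. -/
abbrev Wavefront : Type _ :=
  perp g Z ⧸ (Submodule.span (Fn E N) {Z}).submoduleOf (perp g Z)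

/-- The class `[X]` in `Γ(Z_⊥ / Z)` of a vector field orthogonal to `Z`. -/
def cls (X : perp g Z) : Wavefront g Z := Submodule.Quotient.mk X

theorem cls_eq_iff (X Y : perp g Z) :
    cls g Z X = cls g Z Y ↔ ∃ f : Fn E N, Y.1 = X.1 + f • Z := by
  rw [cls, cls, eq_comm, Submodule.Quotient.eq, Submodule.submoduleOf, Submodule.mem_comap,
    Submodule.mem_span_singleton]
  simp only [Submodule.subtype_apply, AddSubgroupClass.coe_sub]
  exact exists_congr fun f => ⟨fun h => by rw [h]; abel, fun h => by rw [h]; abel⟩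

end Wavefront

section Connection

variable (E : Type*) [NormedAddCommGroup E] [NormedSpace ℝ E]
  (N : Type*) [TopologicalSpace N] [ChartedSpace E N] [IsManifold 𝓘(ℝ, E) ∞ N]
  (Γ : Type*) [AddCommGroup Γ] [Module (Fn E N) Γ]

/-- A linear connection `𝔛(N) × Γ → Γ` on a module `Γ` of sections: `C^∞(N)`-linear in the
vector field, additive in the section, and satisfying the Leibniz rule. -/
structure LinearConnection where
  toFun : VF E N → Γ → Γ
  add_left (V W : VF E N) (s : Γ) : toFun (V + W) s = toFun V s + toFun W s
  smul_left (f : Fn E N) (V : VF E N) (s : Γ) : toFun (f • V) s = f • toFun V s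
  add_right (V : VF E N) (s t : Γ) : toFun V (s + t) = toFun V s + toFun V t
  leibniz (V : VF E N) (f : Fn E N) (s : Γ) : toFun V (f • s) = f • toFun V s + dirDeriv V f • s

variable {E N Γ} [FiniteDimensional ℝ E]

/-- A connection is flat if its curvature endomorphisms vanish. -/
def LinearConnection.IsFlat (D : LinearConnection E N Γ) : Prop :=
  ∀ (V W : VF E N) (s : Γ),
    D.toFun V (D.toFun W s) - D.toFun W (D.toFun V s) - D.toFun (bracket V W) s = 0

/-- The curvature `R(X, Y) V = ∇_X ∇_Y V - ∇_Y ∇_X V - ∇_[X, Y] V` of the Levi-Civita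
connection. -/
def curvature (g : LorentzianMetric E N) (X Y V : VF E N) (x : N) : TangentSpace 𝓘(ℝ, E) x :=
  leviCivita g X (leviCivita g Y V) x - leviCivita g Y (leviCivita g X V) x
    - leviCivita g (bracket X Y) V x

/-- The condition `R|_{Z_⊥ ∧ Z_⊥} = 0`: `R(X, Y) V = 0` for all `X, Y` orthogonal to `Z` and
all `V`. -/
def CurvatureVanishesOnPerp (g : LorentzianMetric E N) (Z : VF E N) : Prop :=
  ∀ X ∈ perp g Z, ∀ Y ∈ perp g Z, ∀ (V : VF E N) (x : N), curvature g X Y V x = 0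

/-- `(N, g)` is a pp-wave: it admits a global parallel null vector field `Z` such that
`R|_{Z_⊥ ∧ Z_⊥} = 0`. -/
def IsPPWave (g : LorentzianMetric E N) : Prop :=
  ∃ Z : VF E N, IsNull g Z ∧ IsParallel g Z ∧ CurvatureVanishesOnPerp g Z

end Connection

end PPWave

end

open PPWave

/-! The signature makes $g$ positive semidefinite on $Z_x^\perp$ with kernel $\mathbb R Z_x$, so $g$
descends to a positive-definite form on the quotient. Metricity together with $\nabla Z=0$ shows
that $\nabla_V$ preserves $\Gamma(Z_\perp)$, and $\nabla_V(fZ)=V(f)Z$, so $\nabla$ descends too.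

The curvature of the induced connection sends $[Y]$ to $[R(V,W)Y]$. Flatness therefore means that
$R(V,W)$ maps $Z_\perp$ into multiples of $Z$. The pair symmetry $g(R(X,Y)V,W)=g(R(V,W)X,Y)$ turns
this into $R(X,Y)V=0$ for $X,Y\perp Z$ (`wavefrontConnection_isFlat_iff_curvatureVanishesOnPerp`).
The converse also uses that a null field orthogonal to $Z$ is a smooth multiple of $Z$
(`IsNull.exists_eq_fn_smul`).

A pp-wave may carry a field $Z'$ different from $Z$, so the curvature condition has to be moved from
$Z'$ to $Z$ (`CurvatureVanishesOnPerp.of_parallel_null`). Where the two null fields are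
proportional, their orthogonal complements agree. Elsewhere $Z$ is transverse to $Z'_\perp$ and is
annihilated by $R$, which forces $R=0$ at the point.

The Riemannian identities used here are all derived from the Koszul formula, nondegeneracy and the
Jacobi identity. -/

open Bundle
open scoped Manifold ContDiff Topology

noncomputable section

namespace PPWave

/-! ### Global extension of tangent vectors, and smoothness tested through the metric -/

section Basics

variable {E : Type*} [NormedAddCommGroup E] [NormedSpace ℝ E] [FiniteDimensional ℝ E]
  {N : Type*} [TopologicalSpace N] [ChartedSpace E N] [IsManifold 𝓘(ℝ, E) ∞ N]

/-- Every tangent vector extends to a global vector field, which near the base point agrees with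
the standard local extension. -/
theorem exists_vectorField_eventuallyEq [T2Space N] {x : N} (v : TangentSpace 𝓘(ℝ, E) x) :
    ∃ X : VF E N, ∀ᶠ y in 𝓝 x, X y = FiberBundle.extend E v y := by
  obtain ⟨s, hs, hsmooth⟩ := FiberBundle.exists_contMDiffOn_extend 𝓘(ℝ, E) E (k := ∞) v
  obtain ⟨u, hus, hu, hxu⟩ := mem_nhds_iff.1 hs
  obtain ⟨f, hf, -⟩ := (SmoothBumpFunction.nhds_basis_support (I := 𝓘(ℝ, E))
    (hu.mem_nhds hxu)).mem_iff.1 (hu.mem_nhds hxu)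
  refine ⟨⟨_, ContMDiffOn.smul_section_of_tsupport (f.contMDiff.contMDiffOn) hu hf
    (hsmooth.mono hus)⟩, ?_⟩
  filter_upwards [f.eventuallyEq_one] with y hy
  change f y • FiberBundle.extend E v y = _
  rw [hy, Pi.one_apply, one_smul]

theorem exists_vectorField_apply_eq [T2Space N] {x : N} (v : TangentSpace 𝓘(ℝ, E) x) :
    ∃ X : VF E N, X x = v := by
  obtain ⟨X, hX⟩ := exists_vectorField_eventuallyEq v
  exact ⟨X, by simpa using hX.self_of_nhds⟩

/-- A vector field is smooth if its inner products with all smooth vector fields are. -/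
theorem LorentzianMetric.contMDiff_of_inner [T2Space N] (g : LorentzianMetric E N)
    {σ : (x : N) → TangentSpace 𝓘(ℝ, E) x}
    (h : ∀ W : VF E N, ContMDiff 𝓘(ℝ, E) 𝓘(ℝ, ℝ) ∞ fun x => g.inner x (σ x) (W x)) :
    ContMDiff 𝓘(ℝ, E) (𝓘(ℝ, E).prod 𝓘(ℝ, E)) ∞
      (fun x => TotalSpace.mk' E (E := fun x : N => TangentSpace 𝓘(ℝ, E) x) x (σ x)) := by
  intro x₀
  have : CompleteSpace E := FiniteDimensional.complete ℝ E
  rw [contMDiffAt_section]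
  set t := trivializationAt E (TangentSpace 𝓘(ℝ, E)) x₀ with ht
  have hbase : ∀ᶠ y in 𝓝 x₀, y ∈ t.baseSet :=
    t.open_baseSet.mem_nhds (FiberBundle.mem_baseSet_trivializationAt' x₀)
  have hG := ((contMDiffAt_hom_bundle _).1 (g.contMDiff x₀)).2
  set G : N → E →L[ℝ] E →L[ℝ] ℝ := fun y =>
    ContinuousLinearMap.inCoordinates E (TangentSpace 𝓘(ℝ, E)) (E →L[ℝ] ℝ)
      (fun x : N => TangentSpace 𝓘(ℝ, E) x →L[ℝ] ℝ) x₀ y x₀ y (g.inner y) with hGdef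
  have hGapp : ∀ y ∈ t.baseSet, ∀ a b : E, G y a b = g.inner y (t.symm y a) (t.symm y b) := by
    intro y hy a b
    exact (inCoordinates_apply_eq₂ (E₃ := fun _ : N => ℝ) hy hy (by simp)).trans (by simp; rfl)
  have hGinv : ∀ y ∈ t.baseSet, (G y).IsInvertible := by
    intro y hy
    have hinj : Function.Injective (G y) := by
      refine (injective_iff_map_eq_zero (G y)).2 fun a ha => ?_
      have h0 : t.symm y a = 0 := g.eq_zero_of_inner y _ fun w => by
        have := hGapp y hy a (t ⟨y, w⟩).2
        rw [ha] at this
        simpa [hy] using this.symm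
      rw [← t.linearMapAt_symm (R := ℝ) hy a, h0, map_zero]
    have hrank : Module.finrank ℝ E = Module.finrank ℝ (E →L[ℝ] ℝ) := by
      rw [← (LinearMap.toContinuousLinearMap (𝕜 := ℝ) (E := E) (F' := ℝ)).finrank_eq]
      exact (Subspace.dual_finrank_eq (K := ℝ)).symm
    exact ⟨(LinearEquiv.ofInjectiveOfFinrankEq (G y).toLinearMap hinj
      hrank).toContinuousLinearEquiv, by ext; rfl⟩
  let s : N → E := fun y => (t ⟨y, σ y⟩).2
  have hs : ∀ y ∈ t.baseSet, t.symm y (s y) = σ y := fun y hy => by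
    simp [s, hy]
  -- The components of the covector `G y (s y)` are inner products of `σ` with global fields `W`
  -- that equal the local frame near `x₀`, so `h` applies to them.
  have hφ : ContMDiffAt 𝓘(ℝ, E) 𝓘(ℝ, E →L[ℝ] ℝ) ∞ (fun y => G y (s y)) x₀ := by
    let b := Module.finBasis ℝ E
    let c := fun i => LinearMap.toContinuousLinearMap (b.coord i)
    have hf : (fun y => G y (s y)) = fun y => ∑ i, G y (s y) (b i) • c i := by
      ext y w
      conv_lhs => rw [← b.sum_repr w]
      simp only [map_sum, map_smul]
      simp [c, mul_comm]
    rw [hf]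
    refine ContMDiffAt.sum fun i _ => ?_
    suffices hi : ContMDiffAt 𝓘(ℝ, E) 𝓘(ℝ, ℝ) ∞ (fun y => G y (s y) (b i)) x₀ from
      hi.smul contMDiffAt_const
    obtain ⟨W, hW⟩ := exists_vectorField_eventuallyEq (x := x₀) (t.symm x₀ (b i))
    refine (h W x₀).congr_of_eventuallyEq ?_
    filter_upwards [hW, hbase] with y hy hyb
    rw [hGapp y hyb, hs y hyb, hy]
    rw [FiberBundle.extend, ← ht, t.apply_mk_symm hbase.self_of_nhds]
  -- `s` is recovered as `G⁻¹ (G s)`; inversion is smooth at invertible operators, and nondegeneracy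
  -- makes `G` invertible.
  have hmain := ContMDiffAt.clm_apply
    (((hGinv x₀ hbase.self_of_nhds).contDiffAt_map_inverse (n := ∞)).contMDiffAt.comp x₀ hG) hφ
  refine hmain.congr_of_eventuallyEq ?_
  filter_upwards [hbase] with y hy
  change s y = (G y).inverse (G y (s y))
  obtain ⟨e, he⟩ := hGinv y hy
  rw [← he]
  simp

/-- The smooth function `g(X, Y)`. -/
def LorentzianMetric.innerFn (g : LorentzianMetric E N) (X Y : VF E N) : Fn E N :=
  ⟨fun x => g.inner x (X x) (Y x), fun x => by
    have h := ContMDiffAt.clm_bundle_apply₂ (E₃ := Bundle.Trivial N ℝ) (F₃ := ℝ)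
      (g.contMDiff x) (X.contMDiff x) (Y.contMDiff x)
    exact (contMDiffAt_totalSpace.1 h).2⟩

end Basics

/-! ### Calculus of directional derivatives and Lie brackets -/

section FieldAlgebra

variable {E : Type*} [NormedAddCommGroup E] [NormedSpace ℝ E]
  {N : Type*} [TopologicalSpace N] [ChartedSpace E N]

theorem Fn.mdifferentiableAt (f : Fn E N) (x : N) : MDifferentiableAt 𝓘(ℝ, E) 𝓘(ℝ, ℝ) f x :=
  (f.contMDiff x).mdifferentiableAt (by simp)

/-- Needed because the Koszul formula and the proof of pair symmetry yield identities only after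
multiplication by 2. -/
theorem Fn.eq_of_two_mul_eq {f h : Fn E N} (hfh : 2 * f = 2 * h) : f = h := by
  ext x
  have := DFunLike.congr_fun hfh x
  rw [two_mul, two_mul, ContMDiffMap.coe_add, ContMDiffMap.coe_add, Pi.add_apply,
    Pi.add_apply] at this
  linarith

variable [IsManifold 𝓘(ℝ, E) ∞ N]

@[simp]
theorem dirDeriv_apply (V : VF E N) (f : Fn E N) (x : N) :
    dirDeriv V f x = mvfderiv 𝓘(ℝ, E) f x (V x) := rfl

theorem dirDeriv_add_left (V W : VF E N) (f : Fn E N) :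
    dirDeriv (V + W) f = dirDeriv V f + dirDeriv W f := by
  ext x; simp

theorem dirDeriv_smul_left (h : Fn E N) (V : VF E N) (f : Fn E N) :
    dirDeriv (h • V) f = h * dirDeriv V f := by
  ext x; simp

theorem dirDeriv_add (V : VF E N) (f h : Fn E N) :
    dirDeriv V (f + h) = dirDeriv V f + dirDeriv V h := by
  ext x
  simp [mvfderiv_add (Fn.mdifferentiableAt f x) (Fn.mdifferentiableAt h x)]

theorem dirDeriv_mul (V : VF E N) (f h : Fn E N) :
    dirDeriv V (f * h) = f * dirDeriv V h + dirDeriv V f * h := by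
  ext x
  simp [mvfderiv_mul (Fn.mdifferentiableAt f x) (Fn.mdifferentiableAt h x), mul_comm]

theorem dirDeriv_zero (V : VF E N) : dirDeriv V (0 : Fn E N) = 0 := by
  simpa using dirDeriv_add V 0 0

theorem dirDeriv_sub (V : VF E N) (f h : Fn E N) :
    dirDeriv V (f - h) = dirDeriv V f - dirDeriv V h := by
  rw [eq_sub_iff_add_eq, ← dirDeriv_add, sub_add_cancel]

variable [FiniteDimensional ℝ E]

@[simp]
theorem bracket_apply (V W : VF E N) (x : N) :
    bracket V W x = VectorField.mlieBracket 𝓘(ℝ, E) V W x := rfl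

theorem bracket_swap (V W : VF E N) : bracket V W = -bracket W V := by
  ext x
  exact VectorField.mlieBracket_swap_apply

theorem bracket_add_right (V W W' : VF E N) :
    bracket V (W + W') = bracket V W + bracket V W' := by
  have : CompleteSpace E := FiniteDimensional.complete ℝ E
  ext x
  exact VectorField.mlieBracket_add_right W.mdifferentiableAt W'.mdifferentiableAt

theorem bracket_add_left (V V' W : VF E N) :
    bracket (V + V') W = bracket V W + bracket V' W := by
  rw [bracket_swap, bracket_add_right, bracket_swap W V, bracket_swap W V']
  abel

theorem bracket_smul_right (V : VF E N) (f : Fn E N) (W : VF E N) :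
    bracket V (f • W) = dirDeriv V f • W + f • bracket V W := by
  have : CompleteSpace E := FiniteDimensional.complete ℝ E
  ext x
  exact VectorField.mlieBracket_smul_right (Fn.mdifferentiableAt f x) W.mdifferentiableAt

theorem bracket_smul_left (f : Fn E N) (V W : VF E N) :
    bracket (f • V) W = f • bracket V W - dirDeriv W f • V := by
  rw [bracket_swap, bracket_smul_right, bracket_swap W V]
  simp only [smul_neg]
  abel

/-- The Jacobi identity. -/
theorem bracket_jacobi (U V W : VF E N) :
    bracket U (bracket V W) = bracket (bracket U V) W + bracket V (bracket U W) := by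
  have : CompleteSpace E := FiniteDimensional.complete ℝ E
  have : IsManifold 𝓘(ℝ, E) (minSmoothness ℝ 3) N := by
    rw [minSmoothness_of_isRCLikeNormedField]
    exact IsManifold.of_le (n := ∞) (WithTop.coe_le_coe.2 le_top)
  have h2 : minSmoothness ℝ 2 ≤ ∞ := by
    rw [minSmoothness_of_isRCLikeNormedField]
    exact WithTop.coe_le_coe.2 le_top
  ext x
  exact VectorField.leibniz_identity_mlieBracket_apply ((U.contMDiff x).of_le h2)
    ((V.contMDiff x).of_le h2) ((W.contMDiff x).of_le h2)

end FieldAlgebra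

/-! ### The Levi-Civita connection as an operator on smooth fields -/

section LeviCivitaAlgebra

variable {E : Type*} [NormedAddCommGroup E] [NormedSpace ℝ E]
  {N : Type*} [TopologicalSpace N] [ChartedSpace E N] [IsManifold 𝓘(ℝ, E) ∞ N]
  (g : LorentzianMetric E N)

namespace LorentzianMetric

@[simp]
theorem innerFn_apply (X Y : VF E N) (x : N) : g.innerFn X Y x = g.inner x (X x) (Y x) := rfl

theorem innerFn_comm (X Y : VF E N) : g.innerFn X Y = g.innerFn Y X := by
  ext x; exact g.symm _ _ _

theorem innerFn_add_left (X X' Y : VF E N) :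
    g.innerFn (X + X') Y = g.innerFn X Y + g.innerFn X' Y := by
  ext x; simp

theorem innerFn_add_right (X Y Y' : VF E N) :
    g.innerFn X (Y + Y') = g.innerFn X Y + g.innerFn X Y' := by
  ext x; simp

theorem innerFn_sub_left (X X' Y : VF E N) :
    g.innerFn (X - X') Y = g.innerFn X Y - g.innerFn X' Y := by
  ext x; simp

theorem innerFn_neg_left (X Y : VF E N) : g.innerFn (-X) Y = -g.innerFn X Y := by
  ext x; simp

theorem innerFn_smul_left (f : Fn E N) (X Y : VF E N) :
    g.innerFn (f • X) Y = f * g.innerFn X Y := by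
  ext x; simp

theorem innerFn_smul_right (X : VF E N) (f : Fn E N) (Y : VF E N) :
    g.innerFn X (f • Y) = f * g.innerFn X Y := by
  ext x; simp

theorem innerFn_zero_left (Y : VF E N) : g.innerFn 0 Y = 0 := by
  ext x; simp

variable [FiniteDimensional ℝ E] [T2Space N]

/-- The signature supplies a timelike vector at each point, which is nonzero; any global extension
of it works. -/
theorem exists_vectorField_ne_zero (g : LorentzianMetric E N) (x : N) : ∃ X : VF E N, X x ≠ 0 := by
  obtain ⟨v, hv, -⟩ := g.signature x
  obtain ⟨X, hX⟩ := exists_vectorField_apply_eq v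
  refine ⟨X, fun h => hv.ne ?_⟩
  rw [← hX, h]
  simp

theorem eq_of_innerFn_eq {A B : VF E N} (h : ∀ W, g.innerFn A W = g.innerFn B W) : A = B := by
  ext x
  rw [← sub_eq_zero]
  refine g.eq_zero_of_inner x _ fun w => ?_
  obtain ⟨W, rfl⟩ := exists_vectorField_apply_eq w
  have := DFunLike.congr_fun (h W) x
  simpa [sub_eq_zero] using this

/-- `[V, W] f = V (W f) - W (V f)`. -/
theorem dirDeriv_bracket (g : LorentzianMetric E N) (V W : VF E N) (f : Fn E N) :
    dirDeriv (bracket V W) f = dirDeriv V (dirDeriv W f) - dirDeriv W (dirDeriv V f) := by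
  -- Expanding the Jacobi identity for `V`, `W`, `f • X` leaves, besides `f` times the Jacobi
  -- identity for `X` and cancelling mixed terms, exactly this multiple of `X`. A field nonvanishing
  -- at the point then isolates the coefficient.
  have key (X : VF E N) : (dirDeriv (bracket V W) f
      - (dirDeriv V (dirDeriv W f) - dirDeriv W (dirDeriv V f))) • X = 0 := by
    have h := bracket_jacobi V W (f • X)
    simp only [bracket_smul_right, bracket_add_right, bracket_jacobi V W X, smul_add] at h
    rw [sub_smul, sub_smul, sub_eq_zero]
    linear_combination (norm := module) -h
  ext x
  obtain ⟨X, hX⟩ := g.exists_vectorField_ne_zero x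
  have := DFunLike.congr_fun (key X) x
  rw [smul_apply] at this
  exact sub_eq_zero.1 ((smul_eq_zero.1 this).resolve_right hX)

/-- The Levi-Civita connection as an operation on smooth vector fields. -/
def nabla (X Y : VF E N) : VF E N :=
  ⟨leviCivita g X Y, g.contMDiff_of_inner fun W => by
    -- The Koszul formula exhibits the inner product with `W` as a combination of smooth functions.
    have h : (fun x => g.inner x (leviCivita g X Y x) (W x)) = ((1 / 2 : ℝ) •
        (dirDeriv X (g.innerFn Y W) + dirDeriv Y (g.innerFn W X) - dirDeriv W (g.innerFn X Y)
          + g.innerFn (bracket X Y) W - g.innerFn (bracket Y W) X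
          + g.innerFn (bracket W X) Y) : Fn E N) := by
      ext x
      have := leviCivita_spec g X.mdifferentiableAt Y.mdifferentiableAt W.mdifferentiableAt (x := x)
      have hk : koszul g X Y W x =
        (dirDeriv X (g.innerFn Y W) + dirDeriv Y (g.innerFn W X) - dirDeriv W (g.innerFn X Y)
          + g.innerFn (bracket X Y) W - g.innerFn (bracket Y W) X
          + g.innerFn (bracket W X) Y) x := rfl
      rw [ContMDiffMap.coe_smul, Pi.smul_apply, ← hk, ← this, smul_eq_mul]
      ring
    rw [h]
    exact ContMDiffMap.contMDiff _⟩

theorem two_mul_innerFn_nabla (X Y W : VF E N) :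
    2 * g.innerFn (g.nabla X Y) W
      = dirDeriv X (g.innerFn Y W) + dirDeriv Y (g.innerFn W X) - dirDeriv W (g.innerFn X Y)
          + g.innerFn (bracket X Y) W - g.innerFn (bracket Y W) X + g.innerFn (bracket W X) Y := by
  ext x
  rw [two_mul, ContMDiffMap.coe_add, Pi.add_apply, ← two_mul]
  exact leviCivita_spec g X.mdifferentiableAt Y.mdifferentiableAt W.mdifferentiableAt (x := x)

/-- By nondegeneracy, the linearity and Leibniz rules for $\nabla$ reduce to ring identities between
Koszul expressions. -/
theorem eq_of_two_mul_innerFn_eq {A B : VF E N}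
    (h : ∀ W, 2 * g.innerFn A W = 2 * g.innerFn B W) : A = B := by
  exact g.eq_of_innerFn_eq fun W => Fn.eq_of_two_mul_eq (h W)

theorem nabla_add_left (X X' Y : VF E N) : g.nabla (X + X') Y = g.nabla X Y + g.nabla X' Y := by
  refine g.eq_of_two_mul_innerFn_eq fun W => ?_
  rw [innerFn_add_left, mul_add]
  simp only [two_mul_innerFn_nabla, dirDeriv_add_left, innerFn_add_left, innerFn_add_right,
    dirDeriv_add, bracket_add_left, bracket_add_right]
  ring

theorem nabla_add_right (X Y Y' : VF E N) : g.nabla X (Y + Y') = g.nabla X Y + g.nabla X Y' := by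
  refine g.eq_of_two_mul_innerFn_eq fun W => ?_
  rw [innerFn_add_left, mul_add]
  simp only [two_mul_innerFn_nabla, dirDeriv_add_left, innerFn_add_left, innerFn_add_right,
    dirDeriv_add, bracket_add_left, bracket_add_right]
  ring

theorem nabla_smul_left (f : Fn E N) (X Y : VF E N) : g.nabla (f • X) Y = f • g.nabla X Y := by
  refine g.eq_of_two_mul_innerFn_eq fun W => ?_
  rw [innerFn_smul_left, mul_left_comm]
  simp only [two_mul_innerFn_nabla, dirDeriv_smul_left, innerFn_smul_left, innerFn_smul_right,
    dirDeriv_mul, bracket_smul_left, bracket_smul_right, innerFn_add_left, innerFn_sub_left]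
  rw [g.innerFn_comm W X]
  ring

theorem nabla_smul_right (X : VF E N) (f : Fn E N) (Y : VF E N) :
    g.nabla X (f • Y) = f • g.nabla X Y + dirDeriv X f • Y := by
  refine g.eq_of_two_mul_innerFn_eq fun W => ?_
  rw [innerFn_add_left, innerFn_smul_left, mul_add, mul_left_comm]
  simp only [two_mul_innerFn_nabla, dirDeriv_smul_left, innerFn_smul_left, innerFn_smul_right,
    dirDeriv_mul, bracket_smul_left, bracket_smul_right, innerFn_add_left, innerFn_sub_left]
  rw [g.innerFn_comm W X, g.innerFn_comm Y X]
  ring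

theorem nabla_zero_right (X : VF E N) : g.nabla X 0 = 0 := by
  simpa using g.nabla_add_right X 0 0

theorem nabla_neg_right (X Y : VF E N) : g.nabla X (-Y) = -g.nabla X Y := by
  rw [eq_neg_iff_add_eq_zero, ← nabla_add_right, neg_add_cancel, nabla_zero_right]

theorem nabla_sub_right (X Y Y' : VF E N) : g.nabla X (Y - Y') = g.nabla X Y - g.nabla X Y' := by
  rw [sub_eq_add_neg, nabla_add_right, nabla_neg_right, sub_eq_add_neg]

theorem nabla_neg_left (X Y : VF E N) : g.nabla (-X) Y = -g.nabla X Y := by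
  simpa using g.nabla_smul_left (-1) X Y

theorem nabla_sub_left (X X' Y : VF E N) : g.nabla (X - X') Y = g.nabla X Y - g.nabla X' Y := by
  rw [sub_eq_add_neg, nabla_add_left, nabla_neg_left, sub_eq_add_neg]

theorem nabla_torsion (X Y : VF E N) : g.nabla X Y - g.nabla Y X = bracket X Y := by
  ext x
  exact leviCivita_torsion g X Y x

theorem dirDeriv_innerFn (X Y W : VF E N) :
    dirDeriv X (g.innerFn Y W) = g.innerFn (g.nabla X Y) W + g.innerFn Y (g.nabla X W) := by
  ext x
  exact leviCivita_metric g X Y W x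

/-! ### Symmetries of the curvature tensor -/

/-- The curvature of the Levi-Civita connection as an operation on smooth vector fields. -/
def curv (X Y V : VF E N) : VF E N :=
  g.nabla X (g.nabla Y V) - g.nabla Y (g.nabla X V) - g.nabla (bracket X Y) V

theorem curv_swap (X Y V : VF E N) : g.curv X Y V = -g.curv Y X V := by
  simp only [curv, bracket_swap X Y, nabla_neg_left]
  abel

theorem curv_self (X V : VF E N) : g.curv X X V = 0 := by
  have h : bracket X X = 0 := by
    ext x
    simp
  have h0 : g.nabla 0 V = 0 := by simpa using g.nabla_add_left 0 0 V
  simp [curv, h, h0]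

theorem curv_add_left (X X' Y V : VF E N) :
    g.curv (X + X') Y V = g.curv X Y V + g.curv X' Y V := by
  simp only [curv, bracket_add_left, nabla_add_left, nabla_add_right]
  abel

theorem curv_add_middle (X Y Y' V : VF E N) :
    g.curv X (Y + Y') V = g.curv X Y V + g.curv X Y' V := by
  rw [curv_swap, curv_add_left, g.curv_swap X Y, g.curv_swap X Y']
  abel

/-- The term $(Yf)\nabla_XV$ from $\nabla_Y(f\nabla_XV)$ cancels against the one from
$[fX,Y]=f[X,Y]-(Yf)X$. -/
theorem curv_smul_left (f : Fn E N) (X Y V : VF E N) :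
    g.curv (f • X) Y V = f • g.curv X Y V := by
  simp only [curv, bracket_smul_left, nabla_smul_left, nabla_smul_right, nabla_sub_left, smul_sub]
  abel

theorem curv_smul_middle (f : Fn E N) (X Y V : VF E N) :
    g.curv X (f • Y) V = f • g.curv X Y V := by
  rw [curv_swap, curv_smul_left, g.curv_swap X Y, smul_neg]

theorem curv_sub_left (X X' Y V : VF E N) :
    g.curv (X - X') Y V = g.curv X Y V - g.curv X' Y V := by
  rw [eq_sub_iff_add_eq, ← curv_add_left, sub_add_cancel]

theorem curv_sub_middle (X Y Y' V : VF E N) :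
    g.curv X (Y - Y') V = g.curv X Y V - g.curv X Y' V := by
  rw [eq_sub_iff_add_eq, ← curv_add_middle, sub_add_cancel]

/-- The first Bianchi identity. -/
theorem curv_bianchi (X Y V : VF E N) : g.curv X Y V + g.curv Y V X + g.curv V X Y = 0 := by
  have h1 := g.nabla_torsion Y V
  have h2 := g.nabla_torsion V X
  have h3 := g.nabla_torsion X Y
  have e1 := congrArg (g.nabla X) h1
  have e2 := congrArg (g.nabla Y) h2
  have e3 := congrArg (g.nabla V) h3
  have t1 := g.nabla_torsion X (bracket Y V)
  have t2 := g.nabla_torsion Y (bracket V X)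
  have t3 := g.nabla_torsion V (bracket X Y)
  have hj := bracket_jacobi X Y V
  rw [bracket_swap (bracket X Y) V, bracket_swap X V] at hj
  have hn : bracket Y (-bracket V X) = -bracket Y (bracket V X) := by
    have := bracket_smul_right Y (-1) (bracket V X)
    have h0 : dirDeriv Y (-1 : Fn E N) = 0 := by
      have h01 : dirDeriv Y (1 : Fn E N) = 0 := by
        simpa using dirDeriv_mul Y (1 : Fn E N) 1
      have := dirDeriv_sub Y 0 (1 : Fn E N)
      simpa [h01, dirDeriv_zero] using this
    simpa [h0] using this
  rw [hn] at hj
  simp only [nabla_sub_right] at e1 e2 e3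
  simp only [curv]
  -- Differentiating torsion-freeness cyclically and applying it again to the brackets turns the
  -- cyclic curvature sum into a cyclic sum of double brackets, zero by Jacobi.
  linear_combination (norm := module) e1 + e2 + e3 + t1 + t2 + t3 + hj

/-- The curvature operators are skew-adjoint. -/
theorem innerFn_curv_skew (X Y V W : VF E N) :
    g.innerFn (g.curv X Y V) W = -g.innerFn (g.curv X Y W) V := by
  -- Apply $[X,Y]=XY-YX$ to the function $g(V,W)$ and expand by metricity; products of two first
  -- derivatives cancel.
  have h := g.dirDeriv_bracket X Y (g.innerFn V W)
  simp only [dirDeriv_innerFn, dirDeriv_add] at h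
  simp only [curv, innerFn_sub_left]
  rw [g.innerFn_comm V (g.nabla (bracket X Y) W), g.innerFn_comm V (g.nabla X (g.nabla Y W)),
    g.innerFn_comm V (g.nabla Y (g.nabla X W))] at h
  linear_combination -h

/-- The pair symmetry of the curvature tensor. -/
theorem innerFn_curv_pair_symm (X Y V W : VF E N) :
    g.innerFn (g.curv X Y V) W = g.innerFn (g.curv V W X) Y := by
  have b (A B C D : VF E N) : g.innerFn (g.curv A B C) D + g.innerFn (g.curv B C A) D
      + g.innerFn (g.curv C A B) D = 0 := by
    rw [← innerFn_add_left, ← innerFn_add_left, curv_bianchi, innerFn_zero_left]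
  have s1 (A B C D : VF E N) : g.innerFn (g.curv A B C) D = -g.innerFn (g.curv B A C) D := by
    rw [curv_swap, innerFn_neg_left]
  have s2 := g.innerFn_curv_skew
  -- The octahedron argument: four Bianchi identities, one for each choice of the last slot, are
  -- combined with signs and reduced by the two skew-symmetries.
  have key : 2 * g.innerFn (g.curv X Y V) W = 2 * g.innerFn (g.curv V W X) Y := by
    linear_combination b X Y V W + b Y V W X - b V W X Y - b W X Y V
      - s2 Y V W X - s2 V W Y X + s1 X V W Y - s2 V X W Y + s2 W X Y V + s2 X Y W V
      + s1 Y W X V - s2 W Y X V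
  exact Fn.eq_of_two_mul_eq key

end LorentzianMetric

end LeviCivitaAlgebra

/-! ### Vectors and fields orthogonal to a null field -/

section NullVectors

variable {E : Type*} [NormedAddCommGroup E] [NormedSpace ℝ E]
  {N : Type*} [TopologicalSpace N] [ChartedSpace E N] [IsManifold 𝓘(ℝ, E) ∞ N]
  (g : LorentzianMetric E N)

/-- On the orthogonal complement of a null vector `z` the metric is positive semidefinite, with
kernel spanned by `z`. -/
theorem LorentzianMetric.exists_eq_smul_or_inner_pos {x : N} {z w : TangentSpace 𝓘(ℝ, E) x}
    (hz : z ≠ 0) (hzz : g.inner x z z = 0) (hw : g.inner x w z = 0) :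
    (∃ c : ℝ, w = c • z) ∨ 0 < g.inner x w w := by
  obtain ⟨v, -, hv⟩ := g.signature x
  have hvz : g.inner x v z ≠ 0 := fun h => (hv z h hz).ne' hzz
  -- Chosen so that `w - c • z` is orthogonal to the timelike `v`, where `g` is positive definite;
  -- subtracting a multiple of `z` does not change $g(w,w)$.
  set c : ℝ := g.inner x v w / g.inner x v z with hc
  by_cases hu : w - c • z = 0
  · exact Or.inl ⟨c, sub_eq_zero.1 hu⟩
  · right
    have h := hv (w - c • z) (by
      simp only [map_sub, map_smul, smul_eq_mul, hc]
      field_simp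
      ring) hu
    have hzw : g.inner x z w = 0 := (g.symm x z w).trans hw
    simpa [hw, hzz, hzw] using h

variable {g} {Z : VF E N}

theorem IsNull.exists_eq_smul (hZ : IsNull g Z) {x : N} {w : TangentSpace 𝓘(ℝ, E) x}
    (hw : g.inner x w (Z x) = 0) (hww : g.inner x w w = 0) : ∃ c : ℝ, w = c • Z x :=
  (g.exists_eq_smul_or_inner_pos (hZ x).1 (hZ x).2 hw).resolve_right hww.not_gt

theorem mem_perp_iff {X : VF E N} : X ∈ perp g Z ↔ g.innerFn X Z = 0 :=
  ⟨fun h => by ext x; exact h x, fun h x => DFunLike.congr_fun h x⟩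

variable [FiniteDimensional ℝ E] [T2Space N]

theorem exists_inner_ne_zero {x : N} (hZ : Z x ≠ 0) : ∃ T : VF E N, g.inner x (T x) (Z x) ≠ 0 := by
  by_contra! h
  refine hZ (g.eq_zero_of_inner x _ fun w => ?_)
  obtain ⟨T, rfl⟩ := exists_vectorField_apply_eq w
  rw [g.symm, h]

/-- A null vector field orthogonal to the null field `Z` is a smooth multiple of `Z`. -/
theorem IsNull.exists_eq_fn_smul (hZ : IsNull g Z) {A : VF E N} (hA : A ∈ perp g Z)
    (hAA : g.innerFn A A = 0) : ∃ f : Fn E N, A = f • Z := by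
  have hex : ∀ x, ∃ c : ℝ, A x = c • Z x := fun x =>
    hZ.exists_eq_smul (hA x) (DFunLike.congr_fun hAA x)
  choose f hf using hex
  refine ⟨⟨f, fun x => ?_⟩, by ext x; exact hf x⟩
  obtain ⟨T, hT⟩ := exists_inner_ne_zero (g := g) (hZ x).1
  have hev : ∀ᶠ y in 𝓝 x, g.innerFn T Z y ≠ 0 :=
    (g.innerFn T Z).contMDiff.continuous.continuousAt.eventually_ne hT
  -- Near `x` the coefficient equals $g(T,A)/g(T,Z)$, hence is smooth.
  refine (((g.innerFn T A).contMDiff x).div₀ ((g.innerFn T Z).contMDiff x)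
    hT).congr_of_eventuallyEq ?_
  filter_upwards [hev] with y hy
  rw [Pi.div_apply, eq_div_iff hy, g.innerFn_apply T A, hf y]
  simp

end NullVectors

/-! ### The induced metric on the wavefront bundle -/

section WavefrontMetric

/-- A bilinear map which vanishes when one of its arguments lies in the submodule `S` descends to
the quotient by `S`. -/
def quotientBilin {R P Q : Type*} [CommRing R] [AddCommGroup P] [Module R P] [AddCommGroup Q]
    [Module R Q] (S : Submodule R P) (B : P →ₗ[R] P →ₗ[R] Q) (hl : ∀ s ∈ S, ∀ p, B s p = 0)
    (hr : ∀ s ∈ S, ∀ p, B p s = 0) : (P ⧸ S) →ₗ[R] (P ⧸ S) →ₗ[R] Q :=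
  S.liftQ
    { toFun := fun p => S.liftQ (B p) fun s hs => hr s hs p
      map_add' := fun p p' => Submodule.linearMap_qext _ <|
        LinearMap.ext fun q => LinearMap.congr_fun (map_add B p p') q
      map_smul' := fun c p => Submodule.linearMap_qext _ <|
        LinearMap.ext fun q => LinearMap.congr_fun (map_smul B c p) q }
    fun s hs => Submodule.linearMap_qext _ (LinearMap.ext fun q => hl s hs q)

variable {E : Type*} [NormedAddCommGroup E] [NormedSpace ℝ E]
  {N : Type*} [TopologicalSpace N] [ChartedSpace E N] [IsManifold 𝓘(ℝ, E) ∞ N]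
  (g : LorentzianMetric E N) (Z : VF E N)

theorem inner_eq_zero_of_mem_span {x : N} {z : perpAt g Z x}
    (hz : z ∈ (Submodule.span ℝ {Z x}).submoduleOf (perpAt g Z x)) (w : perpAt g Z x) :
    g.inner x z w = 0 := by
  obtain ⟨c, hc⟩ := Submodule.mem_span_singleton.1 hz
  have hc : c • Z x = (z : TangentSpace 𝓘(ℝ, E) x) := hc
  have hw : g.inner x w (Z x) = 0 := w.2
  rw [← hc, g.symm, map_smul, hw, smul_zero]

/-- The bilinear form induced by the metric on the fibre of the wavefront bundle. -/
def wavefrontInnerAt (x : N) : LinearMap.BilinForm ℝ (WavefrontAt g Z x) :=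
  quotientBilin _
    (LinearMap.mk₂ ℝ (fun v w : perpAt g Z x => g.inner x v w) (by simp) (by simp) (by simp)
      (by simp))
    (fun _ hz w => inner_eq_zero_of_mem_span g Z hz w)
    fun _ hz w => (g.symm x _ _).trans (inner_eq_zero_of_mem_span g Z hz w)

theorem wavefrontInnerAt_clsAt (x : N) (v w : perpAt g Z x) :
    wavefrontInnerAt g Z x (clsAt g Z v) (clsAt g Z w) = g.inner x v w := rfl

theorem wavefrontInnerAt_comm (x : N) (ξ η : WavefrontAt g Z x) :
    wavefrontInnerAt g Z x ξ η = wavefrontInnerAt g Z x η ξ := by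
  obtain ⟨v, rfl⟩ := Submodule.Quotient.mk_surjective _ ξ
  obtain ⟨w, rfl⟩ := Submodule.Quotient.mk_surjective _ η
  exact g.symm x v w

-- A vector of $Z_x^\perp$ with nonpositive square is a multiple of $Z_x$, so its class is zero.
variable {g Z} in
theorem wavefrontInnerAt_pos (hZ : IsNull g Z) {x : N} {ξ : WavefrontAt g Z x} (hξ : ξ ≠ 0) :
    0 < wavefrontInnerAt g Z x ξ ξ := by
  obtain ⟨v, rfl⟩ := Submodule.Quotient.mk_surjective _ ξ
  refine (g.exists_eq_smul_or_inner_pos (hZ x).1 (hZ x).2 v.2).resolve_left ?_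
  rintro ⟨c, hc⟩
  exact hξ ((Submodule.Quotient.mk_eq_zero _).2 (Submodule.mem_span_singleton.2 ⟨c, hc.symm⟩))

theorem innerFn_eq_zero_of_mem_span {X : perp g Z}
    (hX : X ∈ (Submodule.span (Fn E N) {Z}).submoduleOf (perp g Z)) (Y : perp g Z) :
    g.innerFn X Y = 0 := by
  obtain ⟨f, hf⟩ := Submodule.mem_span_singleton.1 hX
  have hf : f • Z = (X : VF E N) := hf
  have hY : g.innerFn Y Z = 0 := by
    ext x
    exact Y.2 x
  rw [← hf, g.innerFn_comm, g.innerFn_smul_right, hY, mul_zero]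

/-- The bilinear map induced by the metric on the sections of the wavefront bundle. -/
def wavefrontInner : Wavefront g Z →ₗ[Fn E N] Wavefront g Z →ₗ[Fn E N] Fn E N :=
  quotientBilin _
    (LinearMap.mk₂ (Fn E N) (fun X Y : perp g Z => g.innerFn X Y)
      (fun _ _ _ => g.innerFn_add_left _ _ _) (fun _ _ _ => g.innerFn_smul_left _ _ _)
      (fun _ _ _ => g.innerFn_add_right _ _ _) (fun _ _ _ => g.innerFn_smul_right _ _ _))
    (fun _ hX Y => innerFn_eq_zero_of_mem_span g Z hX Y)
    fun _ hX Y => (g.innerFn_comm _ _).trans (innerFn_eq_zero_of_mem_span g Z hX Y)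

theorem wavefrontInner_cls_apply (X Y : perp g Z) (x : N) :
    wavefrontInner g Z (cls g Z X) (cls g Z Y) x = g.inner x (X.1 x) (Y.1 x) := rfl

end WavefrontMetric

/-! ### The induced connection on the wavefront bundle -/

section WavefrontConnection

variable {E : Type*} [NormedAddCommGroup E] [NormedSpace ℝ E] [FiniteDimensional ℝ E]
  {N : Type*} [TopologicalSpace N] [T2Space N] [ChartedSpace E N] [IsManifold 𝓘(ℝ, E) ∞ N]
  {g : LorentzianMetric E N} {Z : VF E N}

theorem IsParallel.nabla_eq_zero (hZ : IsParallel g Z) (V : VF E N) : g.nabla V Z = 0 := by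
  ext x
  exact hZ V x

theorem IsParallel.curv_eq_zero (hZ : IsParallel g Z) (V W : VF E N) : g.curv V W Z = 0 := by
  simp [LorentzianMetric.curv, hZ.nabla_eq_zero, g.nabla_zero_right]

theorem IsParallel.nabla_mem_perp (hZ : IsParallel g Z) (V : VF E N) {Y : VF E N}
    (hY : Y ∈ perp g Z) : g.nabla V Y ∈ perp g Z := by
  rw [mem_perp_iff] at hY ⊢
  have h := g.dirDeriv_innerFn V Y Z
  rw [hY, dirDeriv_zero, hZ.nabla_eq_zero, g.innerFn_comm Y, g.innerFn_zero_left, add_zero] at h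
  exact h.symm

/-- The Levi-Civita connection restricted to the sections of `Z_⊥`, for a parallel field `Z`. -/
def nablaPerp (hZ : IsParallel g Z) (V : VF E N) (Y : perp g Z) : perp g Z :=
  ⟨g.nabla V Y.1, hZ.nabla_mem_perp V Y.2⟩

/-- The connection induced on the wavefront bundle. -/
def wavefrontConnection (hZ : IsParallel g Z) : LinearConnection E N (Wavefront g Z) where
  toFun V := Quotient.map' (nablaPerp hZ V) fun X Y hXY => by
    obtain ⟨f, hf⟩ := (cls_eq_iff g Z X Y).1 (Quotient.sound hXY)
    -- Since $\nabla_VZ=0$, replacing $X$ by $X+fZ$ changes $\nabla_VX$ by $V(f)Z$ alone.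
    refine Quotient.exact ((cls_eq_iff g Z _ _).2 ⟨dirDeriv V f, ?_⟩)
    simp only [nablaPerp, hf, g.nabla_add_right, g.nabla_smul_right, hZ.nabla_eq_zero, smul_zero,
      zero_add]
  add_left V W s := by
    obtain ⟨Y, rfl⟩ := Submodule.Quotient.mk_surjective _ s
    exact congrArg (cls g Z) (Subtype.ext (g.nabla_add_left V W Y))
  smul_left f V s := by
    obtain ⟨Y, rfl⟩ := Submodule.Quotient.mk_surjective _ s
    exact congrArg (cls g Z) (Subtype.ext (g.nabla_smul_left f V Y))
  add_right V s t := by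
    obtain ⟨Y, rfl⟩ := Submodule.Quotient.mk_surjective _ s
    obtain ⟨Y', rfl⟩ := Submodule.Quotient.mk_surjective _ t
    exact congrArg (cls g Z) (Subtype.ext (g.nabla_add_right V Y Y'))
  leibniz V f s := by
    obtain ⟨Y, rfl⟩ := Submodule.Quotient.mk_surjective _ s
    exact congrArg (cls g Z) (Subtype.ext (g.nabla_smul_right V f Y))

theorem wavefrontConnection_cls (hZ : IsParallel g Z) (V : VF E N) (Y : perp g Z) :
    (wavefrontConnection hZ).toFun V (cls g Z Y) = cls g Z (nablaPerp hZ V Y) := rfl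

/-! ### Flatness and the pp-wave condition -/

theorem curvatureVanishesOnPerp_iff : CurvatureVanishesOnPerp g Z ↔
    ∀ X ∈ perp g Z, ∀ Y ∈ perp g Z, ∀ V, g.curv X Y V = 0 :=
  ⟨fun h X hX Y hY V => by ext x; exact h X hX Y hY V x,
    fun h X hX Y hY V x => DFunLike.congr_fun (h X hX Y hY V) x⟩

theorem IsParallel.curv_mem_perp (hZ : IsParallel g Z) (V W : VF E N) {Y : VF E N}
    (hY : Y ∈ perp g Z) : g.curv V W Y ∈ perp g Z :=
  sub_mem (sub_mem (hZ.nabla_mem_perp V (hZ.nabla_mem_perp W hY))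
    (hZ.nabla_mem_perp W (hZ.nabla_mem_perp V hY))) (hZ.nabla_mem_perp _ hY)

/-- The induced connection is flat if and only if the curvature of `∇` maps `Z_⊥` to the multiples
of `Z`. -/
theorem wavefrontConnection_isFlat_iff (hZ : IsParallel g Z) :
    (wavefrontConnection hZ).IsFlat ↔
      ∀ V W, ∀ Y ∈ perp g Z, ∃ f : Fn E N, g.curv V W Y = f • Z := by
  have key (V W : VF E N) (Y : perp g Z) :
      (wavefrontConnection hZ).toFun V ((wavefrontConnection hZ).toFun W (cls g Z Y))
        - (wavefrontConnection hZ).toFun W ((wavefrontConnection hZ).toFun V (cls g Z Y))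
        - (wavefrontConnection hZ).toFun (bracket V W) (cls g Z Y)
        = cls g Z ⟨g.curv V W Y.1, hZ.curv_mem_perp V W Y.2⟩ := rfl
  have hzero (X : perp g Z) : cls g Z X = 0 ↔ ∃ f : Fn E N, X.1 = f • Z := by
    rw [show (0 : Wavefront g Z) = cls g Z 0 from rfl, eq_comm, cls_eq_iff]
    simp
  constructor
  · intro h V W Y hY
    exact (hzero _).1 ((key V W ⟨Y, hY⟩).symm.trans (h V W (cls g Z ⟨Y, hY⟩)))
  · intro h V W s
    obtain ⟨Y, rfl⟩ := Submodule.Quotient.mk_surjective _ s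
    exact (key V W Y).trans ((hzero _).2 (h V W Y.1 Y.2))

/-- Pair symmetry exchanges the two conditions. If $R(V,W)X=fZ$, then $g(R(X,Y)V,W)=f\,g(Z,Y)=0$.
Conversely $A=R(V,W)Y$ lies in $Z_\perp$ and $g(A,A)=g(R(Y,A)V,W)=0$, so $A$ is null and hence a
multiple of $Z$. -/
theorem wavefrontConnection_isFlat_iff_curvatureVanishesOnPerp (hnull : IsNull g Z)
    (hpar : IsParallel g Z) :
    (wavefrontConnection hpar).IsFlat ↔ CurvatureVanishesOnPerp g Z := by
  rw [wavefrontConnection_isFlat_iff, curvatureVanishesOnPerp_iff]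
  constructor
  · intro h X hX Y hY V
    refine g.eq_of_innerFn_eq fun W => ?_
    obtain ⟨f, hf⟩ := h V W X hX
    rw [g.innerFn_curv_pair_symm, hf, g.innerFn_smul_left, g.innerFn_comm, mem_perp_iff.1 hY,
      g.innerFn_zero_left, mul_zero]
  · intro h V W Y hY
    have hmem := hpar.curv_mem_perp V W hY
    refine hnull.exists_eq_fn_smul hmem ?_
    rw [g.innerFn_curv_pair_symm V W Y, h Y hY _ hmem, g.innerFn_zero_left]

/-- The vanishing of the curvature on the orthogonal complement of a parallel null field does not
depend on the choice of the field. -/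
theorem CurvatureVanishesOnPerp.of_parallel_null {Z' : VF E N}
    (h : CurvatureVanishesOnPerp g Z') (hnull' : IsNull g Z')
    (hnull : IsNull g Z) (hpar : IsParallel g Z) : CurvatureVanishesOnPerp g Z := by
  rw [curvatureVanishesOnPerp_iff] at h
  intro X hX Y hY V x
  -- The hypothesis concerns fields orthogonal to $Z'$ everywhere, but `X` and `Y` need not be.
  -- Projecting along an auxiliary field `T` makes them so, and tensoriality then allows a pointwise
  -- conclusion.
  have hproj (T A : VF E N) : g.innerFn T Z' • A - g.innerFn A Z' • T ∈ perp g Z' := by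
    rw [mem_perp_iff, g.innerFn_sub_left, g.innerFn_smul_left, g.innerFn_smul_left]
    ring
  have hexp (T : VF E N) := h _ (hproj T X) _ (hproj T Y) V
  simp only [g.curv_sub_left, g.curv_sub_middle, g.curv_smul_left, g.curv_smul_middle,
    g.curv_self, smul_zero, sub_zero] at hexp
  change g.curv X Y V x = 0
  by_cases hx : g.inner x (Z' x) (Z x) = 0
  -- Orthogonal null vectors are proportional, so `X` and `Y` are orthogonal to $Z'$ at `x`; only
  -- $g(T,Z')^2R(X,Y)V$ survives there.
  · obtain ⟨c, hc⟩ := hnull.exists_eq_smul hx (hnull' x).2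
    obtain ⟨T, hT⟩ := exists_inner_ne_zero (g := g) (hnull' x).1
    have hXx : g.inner x (X x) (Z x) = 0 := hX x
    have hYx : g.inner x (Y x) (Z x) = 0 := hY x
    have hX' : g.inner x (X x) (Z' x) = 0 := by rw [hc, map_smul, hXx, smul_zero]
    have hY' : g.inner x (Y x) (Z' x) = 0 := by rw [hc, map_smul, hYx, smul_zero]
    have hT' := DFunLike.congr_fun (hexp T) x
    simpa [hX', hY', hT] using hT'
  -- Here `Z` itself serves as `T`: $R(A,Z)=0$ by pair symmetry and $R(V,W)Z=0$, leaving
  -- $g(Z,Z')^2R(X,Y)V=0$.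
  · have hcurvZ (A : VF E N) : g.curv A Z V = 0 := by
      refine g.eq_of_innerFn_eq fun W => ?_
      rw [g.innerFn_curv_pair_symm, g.innerFn_curv_skew, hpar.curv_eq_zero, g.innerFn_zero_left,
        g.innerFn_zero_left, neg_zero]
    have hT' := DFunLike.congr_fun (hexp Z) x
    rw [g.symm] at hx
    simpa [hcurvZ, g.curv_swap Z Y, hx] using hT'

end WavefrontConnection

end PPWave

end

/-! ### The main theorem -/

theorem theorem4p2 {E : Type*} [NormedAddCommGroup E] [NormedSpace ℝ E] [FiniteDimensional ℝ E]
    {M : Type*} [TopologicalSpace M] [T2Space M] [ChartedSpace E M] [IsManifold 𝓘(ℝ, E) ∞ M]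
    (g : LorentzianMetric E M) (U : TopologicalSpace.Opens M) (Z : VF E U)
    (hnull : IsNull (g.restrict U) Z) (hpar : IsParallel (g.restrict U) Z) :
    ∃ (gbar : ∀ x : U, LinearMap.BilinForm ℝ (WavefrontAt (g.restrict U) Z x))
      (Gbar : Wavefront (g.restrict U) Z →ₗ[Fn E U]
        Wavefront (g.restrict U) Z →ₗ[Fn E U] Fn E U)
      (nbar : LinearConnection E U (Wavefront (g.restrict U) Z)),
      -- the fibrewise positive-definite inner product induced by the metric
      (∀ (x : U) (v w : perpAt (g.restrict U) Z x),
        gbar x (clsAt (g.restrict U) Z v) (clsAt (g.restrict U) Z w)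
          = (g.restrict U).inner x v w) ∧
      (∀ (x : U) (ξ η : WavefrontAt (g.restrict U) Z x), gbar x ξ η = gbar x η ξ) ∧
      (∀ (x : U) (ξ : WavefrontAt (g.restrict U) Z x), ξ ≠ 0 → 0 < gbar x ξ ξ) ∧
      -- it depends smoothly on the point: the product of two sections is a smooth function
      (∀ (X Y : perp (g.restrict U) Z) (x : U),
        Gbar (cls (g.restrict U) Z X) (cls (g.restrict U) Z Y) x
          = gbar x (clsAt (g.restrict U) Z (evalAt (g.restrict U) Z X x))
              (clsAt (g.restrict U) Z (evalAt (g.restrict U) Z Y x))) ∧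
      -- the induced connection: the derivative of a section of the orthogonal bundle is again one
      (∀ (V : VF E U) (Y : perp (g.restrict U) Z),
        ∃ DY : perp (g.restrict U) Z,
          (∀ x : U, DY.1 x = leviCivita (g.restrict U) V Y.1 x) ∧
          nbar.toFun V (cls (g.restrict U) Z Y) = cls (g.restrict U) Z DY) ∧
      -- flatness
      (nbar.IsFlat ↔ CurvatureVanishesOnPerp (g.restrict U) Z) ∧
      (nbar.IsFlat ↔ IsPPWave (g.restrict U)) := by
  refine ⟨wavefrontInnerAt (g.restrict U) Z, wavefrontInner (g.restrict U) Z,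
    wavefrontConnection hpar, wavefrontInnerAt_clsAt (g.restrict U) Z,
    wavefrontInnerAt_comm (g.restrict U) Z, fun x ξ hξ => wavefrontInnerAt_pos hnull hξ,
    wavefrontInner_cls_apply (g.restrict U) Z,
    fun V Y => ⟨nablaPerp hpar V Y, fun x => rfl, wavefrontConnection_cls hpar V Y⟩,
    wavefrontConnection_isFlat_iff_curvatureVanishesOnPerp hnull hpar, ?_⟩
  rw [wavefrontConnection_isFlat_iff_curvatureVanishesOnPerp hnull hpar]
  -- One direction takes $Z'=Z$; in the other the pp-wave field is arbitrary, so its curvature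
  -- condition is transferred to `Z`.
  exact ⟨fun h => ⟨Z, hnull, hpar, h⟩,
    fun ⟨_, hnull', _, h⟩ => h.of_parallel_null hnull' hnull hpar⟩
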